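/- A linear game with $n\times n$ inputs and $d\ge 1$ outputs is given by integers $k_{xy}$ ($1\le x,y\le n$), equivalently by the $n\times n$ matrix $(\omega^{k_{xy}})$ with $\omega=e^{2\pi i/d}$: a pair of questions $(x,y)$ is drawn uniformly at random, Alice answers $a(x)\in\mathbb Z_d$, Bob answers $b(y)\in\mathbb Z_d$, and they win if $b(y)=a(x)+k_{xy}\pmod d$. Its classical value $p_{Cl}$ is the maximum, over all functions $a,b:\{1,\dots,n\}\to\mathbb Z_d$, of the winning probability. For $s\ge 1$ and a prime $p$ let Rudin's set be $A(s,p)=\{x_0,\dots,x_{p-1}\}$ with $x_k=\sum_{i=0}^{s-1}\lambda(k^{s-i})(sp)^i$, where $\lambda(m)\in\{0,\dots,p-1\}$ is the residue of $m$ modulo $p$. Let $n\ge 2$. (1) For every integer $s$ with $1\le s\le n$ there are a prime $p$ with $n^2<p<2n^2$ and an $n\times n$ array $(k_{xy})$ of pairwise distinct elements of $A(s,p)$; and for every such $p$ and $(k_{xy})$ the linear game with exponents $k_{xy}$ and $d=(sp)^s$ outputs satisfies $d\le(2sn^2)^s$ and $p_{Cl}\le 2n^{-1+\frac1s}$. (2)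 For $s=n$ every such game (and such games exist) has $d\le 2^n n^{3n}$ outputs and $p_{Cl}=\frac{2n-1}{n^2}$. (3) The value in (2) is the smallest possible: every $n\times n$ linear game, with any number $d\ge1$ of outputs, has $p_{Cl}\ge\frac{2n-1}{n^2}$. -/

import Mathlib

/-- A two-player nonlocal game with question sets `X`, `Y` and answer sets `A`, `B`:
a probability distribution `prob` on `X × Y`, and a winning predicate. -/
structure NonlocalGame (X Y A B : Type*) [Fintype X] [Fintype Y] where
  /-- the probability of the pair of questions `(x, y)` -/
  prob : X → Y → ℝ
  prob_nonneg : ∀ x y, 0 ≤ prob x y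
  sum_prob : ∑ x, ∑ y, prob x y = 1
  /-- `Pred x y a b`: the answers `a`, `b` win on the questions `x`, `y` -/
  Pred : X → Y → A → B → Prop

open Classical in
/-- The winning probability of the deterministic strategy `x ↦ a x`, `y ↦ b y`. -/
noncomputable def NonlocalGame.winProb {X Y A B : Type*} [Fintype X] [Fintype Y]
    (G : NonlocalGame X Y A B) (a : X → A) (b : Y → B) : ℝ :=
  ∑ x, ∑ y, G.prob x y * (if G.Pred x y (a x) (b y) then 1 else 0)

/-- The classical value: the largest winning probability of a deterministic strategy.
(For finite nonempty answer sets the supremum is over a finite nonempty family: a maximum.) -/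
noncomputable def NonlocalGame.classicalValue {X Y A B : Type*} [Fintype X] [Fintype Y]
    (G : NonlocalGame X Y A B) : ℝ :=
  ⨆ st : (X → A) × (Y → B), G.winProb st.1 st.2

/-- The linear game with `nA × nB` inputs and `d ≥ 1` outputs for each player whose matrix is
`M x y = ω ^ (k x y)`, `ω = exp (2 π i / d)`: the questions are uniformly distributed, and the
answers `a`, `b` win on `x`, `y` exactly when `b = a + k x y` modulo `d`. -/
noncomputable def linearGame {nA nB : ℕ} [NeZero nA] [NeZero nB] (d : ℕ)
    (k : Fin nA → Fin nB → ℕ) :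
    NonlocalGame (Fin nA) (Fin nB) (ZMod d) (ZMod d) where
  prob _ _ := 1 / ((nA : ℝ) * nB)
  prob_nonneg _ _ := by positivity
  sum_prob := by
    have hA : (nA : ℝ) ≠ 0 := Nat.cast_ne_zero.mpr (NeZero.ne nA)
    have hB : (nB : ℝ) ≠ 0 := Nat.cast_ne_zero.mpr (NeZero.ne nB)
    simp only [Finset.sum_const, Finset.card_univ, Fintype.card_fin, nsmul_eq_mul]
    field_simp
  Pred x y a b := b = a + (k x y : ZMod d)

/-- Rudin's integer `x_k = ∑_{i < s} λ(k ^ (s - i)) (s p) ^ i`, where `λ(m)` is the residue of `m`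
modulo `p` in `{0, …, p - 1}`. -/
def rudinInt (s p k : ℕ) : ℕ :=
  ∑ i ∈ Finset.range s, (k ^ (s - i) % p) * (s * p) ^ i

/-- Rudin's set `A(s, p) = {x_0, …, x_{p-1}}`. -/
def rudinSet (s p : ℕ) : Finset ℕ :=
  (Finset.range p).image (rudinInt s p)

/-- `k` is an `n × n` array of pairwise distinct integers from Rudin's set `A(s, p)`, where `p` is
a prime strictly between `n ^ 2` and `2 * n ^ 2`. -/
structure IsRudinArray (n s p : ℕ) (k : Fin n → Fin n → ℕ) : Prop where
  prime : p.Prime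
  lt_p : n ^ 2 < p
  p_lt : p < 2 * n ^ 2
  mem : ∀ x y, k x y ∈ rudinSet s p
  injective : Function.Injective fun xy : Fin n × Fin n => k xy.1 xy.2

/-! Fix a strategy and regard the pairs of questions on which it wins as the edges of a bipartite
graph on `n + n` vertices. Along a walk each edge fixes the difference of two answers, so around a
cycle the alternating sum of the exponents vanishes modulo `d`.

For exponents in Rudin's set, a cycle of length at most `2 s` would thus give two disjoint families
of equal size, at most `s`, with equal sums modulo `(s p) ^ s`. In base `s p` these sums have no
carries, so the digits agree; modulo `p` the digits are the power sums of the indices, and Newton's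
identities make the families equal, a contradiction (`multiset_eq_of_rudinInt_sum_modEq`,
`IsRudinArray.no_short_cycle`).

The Moore bound for irregular bipartite graphs (`card_edgeFinset_le_of_no_short_cycle`) then leaves
at most `2 n * n ^ (1/s)` winning pairs. For `s = n` the graph is a forest, with at most `2 n - 1`
edges. Conversely, a strategy can always win on a spanning tree (`le_classicalValue_linearGame`). -/

/-! ### Power sums and Rudin's set -/

/-- Over a field in which `1, …, m` are invertible, two families of size `m` with the same first
`m` power sums have the same elementary symmetric functions. -/
theorem aeval_esymm_eq_of_psum_eq {F : Type*} [Field F] {m : ℕ} (f g : Fin m → F)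
    (hm : ∀ j : ℕ, 1 ≤ j → j ≤ m → (j : F) ≠ 0)
    (h : ∀ j : ℕ, 1 ≤ j → j ≤ m → ∑ i, f i ^ j = ∑ i, g i ^ j) (j : ℕ) (hj : j ≤ m) :
    MvPolynomial.aeval f (MvPolynomial.esymm (Fin m) F j) =
      MvPolynomial.aeval g (MvPolynomial.esymm (Fin m) F j) := by
  induction j using Nat.strong_induction_on with
  | _ j ih =>
    rcases Nat.eq_zero_or_pos j with rfl | hpos
    · simp
    · have key := MvPolynomial.mul_esymm_eq_sum (Fin m) F j
      have hf := congrArg (MvPolynomial.aeval f) key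
      have hg := congrArg (MvPolynomial.aeval g) key
      simp only [map_mul, map_natCast, map_sum, map_pow, map_neg, map_one] at hf hg
      apply mul_left_cancel₀ (hm j hpos hj)
      rw [hf, hg]
      congr 1
      refine Finset.sum_congr rfl fun a ha => ?_
      obtain ⟨ha, hlt⟩ := Finset.mem_filter.1 ha
      rw [Finset.HasAntidiagonal.mem_antidiagonal] at ha
      have h1 := ih a.1 hlt (by omega)
      have h2 := h a.2 (by omega) (by omega)
      have h3 : MvPolynomial.aeval f (MvPolynomial.psum (Fin m) F a.2) =
          MvPolynomial.aeval g (MvPolynomial.psum (Fin m) F a.2) := by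
        simpa [MvPolynomial.psum] using h2
      rw [h1, h3]

/-- Newton: over a field in which `1, …, m` are invertible, a multiset of size `m` is determined
by its first `m` power sums. -/
theorem Multiset.eq_of_sum_pow_eq {F : Type*} [Field F] {K L : Multiset F}
    (hcard : card K = card L) (hm : ∀ j : ℕ, 1 ≤ j → j ≤ card K → (j : F) ≠ 0)
    (h : ∀ j : ℕ, 1 ≤ j → j ≤ card K → (K.map (· ^ j)).sum = (L.map (· ^ j)).sum) :
    K = L := by
  have toFam : ∀ (m : ℕ) (M : Multiset F), card M = m →
      ∃ f : Fin m → F, M = Finset.univ.val.map f := by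
    intro m M hM
    obtain ⟨l, rfl⟩ : ∃ l : List F, (l : Multiset F) = M := Quot.exists_rep M
    obtain rfl : l.length = m := hM
    exact ⟨l.get, by rw [Fin.univ_val_map, List.ofFn_get]⟩
  generalize hmK : card K = m at *
  obtain ⟨f, rfl⟩ := toFam m K hmK
  obtain ⟨g, rfl⟩ := toFam m L hcard.symm
  have hes := aeval_esymm_eq_of_psum_eq f g hm
    (by simpa [Finset.sum, Function.comp_def] using h)
  simp only [MvPolynomial.aeval_esymm_eq_multiset_esymm] at hes
  -- Vieta: the elementary symmetric functions determine the monic polynomial whose roots form the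
  -- multiset.
  have hprod : ((Finset.univ.val.map f).map fun x => Polynomial.X - Polynomial.C x).prod =
      ((Finset.univ.val.map g).map fun x => Polynomial.X - Polynomial.C x).prod := by
    rw [Multiset.prod_X_sub_X_eq_sum_esymm, Multiset.prod_X_sub_X_eq_sum_esymm, hmK, ← hcard]
    refine Finset.sum_congr rfl fun j hj => ?_
    rw [hes j (by simpa [Nat.lt_succ_iff] using hj)]
  simpa only [Polynomial.roots_multiset_prod_X_sub_C] using congrArg Polynomial.roots hprod

/-- Uniqueness of the `s` lowest digits in base `B`. -/
theorem digits_unique_of_modEq {B : ℕ} (s : ℕ) (a b : ℕ → ℕ) (ha : ∀ i < s, a i < B)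
    (hb : ∀ i < s, b i < B)
    (h : ∑ i ∈ Finset.range s, a i * B ^ i ≡ ∑ i ∈ Finset.range s, b i * B ^ i [MOD B ^ s]) :
    ∀ i < s, a i = b i := by
  induction s generalizing a b with
  | zero => simp
  | succ s ih =>
    have hB : 0 < B := (Nat.zero_le _).trans_lt (ha 0 s.succ_pos)
    have expand : ∀ c : ℕ → ℕ, ∑ i ∈ Finset.range (s + 1), c i * B ^ i =
        B * ∑ i ∈ Finset.range s, c (i + 1) * B ^ i + c 0 := by
      intro c
      rw [Finset.sum_range_succ', Finset.mul_sum]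
      simp only [pow_zero, mul_one, pow_succ]
      congr 1
      exact Finset.sum_congr rfl fun i _ => by ring
    rw [expand, expand] at h
    have h0 : a 0 = b 0 := by
      have h' := h.of_dvd (dvd_pow_self B s.succ_ne_zero)
      unfold Nat.ModEq at h'
      rwa [Nat.mul_add_mod, Nat.mul_add_mod, Nat.mod_eq_of_lt (ha 0 s.succ_pos),
        Nat.mod_eq_of_lt (hb 0 s.succ_pos)] at h'
    rw [h0] at h
    have h1 := Nat.ModEq.add_right_cancel' _ h
    rw [pow_succ'] at h1
    have h2 := Nat.ModEq.mul_left_cancel' hB.ne' h1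
    have h3 := ih (fun i => a (i + 1)) (fun i => b (i + 1)) (fun i hi => ha _ (by omega))
      (fun i hi => hb _ (by omega)) h2
    rintro (_ | i) hi
    · exact h0
    · exact h3 i (by omega)

theorem sum_map_rudinInt (s p : ℕ) (K : Multiset ℕ) :
    (K.map (rudinInt s p)).sum =
      ∑ i ∈ Finset.range s, (K.map fun k => k ^ (s - i) % p).sum * (s * p) ^ i := by
  induction K using Multiset.induction_on with
  | empty => simp
  | cons k K ih => simp [ih, rudinInt, add_mul, Finset.sum_add_distrib]

/-- No carries: this is why the base is `s * p` and not `p`. -/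
theorem sum_map_mod_lt {s p : ℕ} (hs : 1 ≤ s) (hp : 0 < p) {K : Multiset ℕ}
    (hK : Multiset.card K ≤ s) (f : ℕ → ℕ) : (K.map fun k => f k % p).sum < s * p := by
  have h1 : (K.map fun k => f k % p).sum ≤ Multiset.card K * (p - 1) := by
    have := Multiset.sum_le_card_nsmul (K.map fun k => f k % p) (p - 1) (by
      intro x hx
      obtain ⟨k, -, rfl⟩ := Multiset.mem_map.1 hx
      exact Nat.le_sub_one_of_lt (Nat.mod_lt _ hp))
    simpa using this
  calc _ ≤ Multiset.card K * (p - 1) := h1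
    _ ≤ s * (p - 1) := Nat.mul_le_mul_right _ hK
    _ < s * p := Nat.mul_lt_mul_of_pos_left (by omega) (by omega)

theorem natCast_sum_map_pow_mod (p j : ℕ) (K : Multiset ℕ) :
    (((K.map fun k => k ^ j % p).sum : ℕ) : ZMod p) =
      ((K.map ((↑) : ℕ → ZMod p)).map (· ^ j)).sum := by
  induction K using Multiset.induction_on with
  | empty => simp
  | cons k K ih => simp [ih]

/-- Rudin: modulo `(s p) ^ s`, the sums of at most `s` elements of `A(s, p)` are distinct. -/
theorem multiset_eq_of_rudinInt_sum_modEq {s p : ℕ} (hs : 1 ≤ s) (hp : p.Prime) (hsp : s < p)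
    {K L : Multiset ℕ} (hKp : ∀ k ∈ K, k < p) (hLp : ∀ k ∈ L, k < p)
    (hcard : Multiset.card K = Multiset.card L) (hK : Multiset.card K ≤ s)
    (h : (K.map (rudinInt s p)).sum ≡ (L.map (rudinInt s p)).sum [MOD (s * p) ^ s]) :
    K = L := by
  have := Fact.mk hp
  rw [sum_map_rudinInt, sum_map_rudinInt] at h
  have hd := digits_unique_of_modEq s _ _
    (fun i _ => sum_map_mod_lt hs hp.pos hK fun k => k ^ (s - i))
    (fun i _ => sum_map_mod_lt hs hp.pos (hcard ▸ hK) fun k => k ^ (s - i)) h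
  have hcast : K.map ((↑) : ℕ → ZMod p) = L.map ((↑) : ℕ → ZMod p) := by
    apply Multiset.eq_of_sum_pow_eq (by simpa using hcard)
    · intro j hj1 hj2 h0
      rw [Multiset.card_map] at hj2
      have := Nat.le_of_dvd hj1 ((ZMod.natCast_eq_zero_iff j p).1 h0)
      omega
    · intro j hj1 hj2
      rw [Multiset.card_map] at hj2
      rw [← natCast_sum_map_pow_mod, ← natCast_sum_map_pow_mod]
      -- The digit in position `s - j` carries the `j`-th powers.
      have := hd (s - j) (by omega)
      rw [Nat.sub_sub_self (by omega : j ≤ s)] at this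
      rw [this]
  have hval : ∀ M : Multiset ℕ, (∀ k ∈ M, k < p) →
      (M.map ((↑) : ℕ → ZMod p)).map ZMod.val = M := by
    intro M hM
    rw [Multiset.map_map]
    conv_rhs => rw [← Multiset.map_id M]
    exact Multiset.map_congr rfl fun k hk => ZMod.val_cast_of_lt (hM k hk)
  rw [← hval K hKp, ← hval L hLp, hcast]

theorem rudinInt_injOn {s p : ℕ} (hs : 1 ≤ s) (hp : p.Prime) (hsp : s < p) :
    Set.InjOn (rudinInt s p) (Set.Iio p) := by
  intro k hk l hl h
  have := multiset_eq_of_rudinInt_sum_modEq (K := {k}) (L := {l}) hs hp hsp (by simpa using hk)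
    (by simpa using hl) (by simp) (by simpa using hs) (by simp only [Multiset.map_singleton, Multiset.sum_singleton, h]; rfl)
  simpa using this

theorem exists_isRudinArray {n s : ℕ} (hn : 2 ≤ n) (hs : 1 ≤ s) (hsn : s ≤ n) :
    ∃ (p : ℕ) (k : Fin n → Fin n → ℕ), IsRudinArray n s p k := by
  obtain ⟨p, hp, h1, h2⟩ := Nat.exists_prime_lt_and_le_two_mul (n ^ 2) (by positivity)
  have hsp : s < p := by nlinarith
  have hidx : ∀ xy : Fin n × Fin n, (finProdFinEquiv xy : ℕ) < p := fun xy =>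
    (finProdFinEquiv xy).isLt.trans (by nlinarith)
  refine ⟨p, fun x y => rudinInt s p (finProdFinEquiv (x, y)), hp, h1, ?_, ?_, ?_⟩
  · refine lt_of_le_of_ne h2 fun h => ?_
    -- Bertrand's postulate allows `p = 2 * n ^ 2`, but that number is even and larger than 2.
    rcases (Nat.dvd_prime hp).1 ⟨n ^ 2, h⟩ with h' | h'
    · omega
    · nlinarith
  · exact fun x y => Finset.mem_image_of_mem _ (Finset.mem_range.2 (hidx (x, y)))
  · intro xy xy' h
    exact finProdFinEquiv.injective
      (Fin.ext (rudinInt_injOn hs hp hsp (hidx xy) (hidx xy') h))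

/-! ### Forests and the Moore bound for bipartite graphs -/

namespace SimpleGraph

/-- A forest with a vertex has fewer edges than vertices. -/
theorem IsAcyclic.card_edgeFinset_lt {V : Type*} [Fintype V] [Nonempty V] {G : SimpleGraph V}
    [Fintype G.edgeSet] (hG : G.IsAcyclic) : G.edgeFinset.card < Fintype.card V := by
  classical
  obtain ⟨T, hGT, -, hT⟩ :=
    (connected_top (V := V)).exists_isTree_le_of_le_of_isAcyclic le_top hG
  rw [← hT.card_edgeFinset]
  exact Nat.lt_succ_of_le (Finset.card_le_card (edgeFinset_mono hGT))

/-- In a graph without cycles of length at most `2 s`, two nonbacktracking walks of length at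
most `s` with the same ends are equal. -/
theorem walk_eq_of_isChain_of_no_short_cycle {V : Type*} {G : SimpleGraph V} {s : ℕ}
    (hG : ∀ (v : V) (c : G.Walk v v), c.IsCycle → 2 * s < c.length) {v w : V}
    (p q : G.Walk v w) (hp : p.edges.IsChain (· ≠ ·)) (hq : q.edges.IsChain (· ≠ ·))
    (hpl : p.length ≤ s) (hql : q.length ≤ s) : p = q := by
  classical
  -- The edges of both walks form a graph with at most `2 s` edges, hence a forest. There a
  -- nonbacktracking walk is a path, and paths are unique.
  set H : SimpleGraph V := fromEdgeSet {e | e ∈ p.edges ++ q.edges} with hH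
  have hHG : H ≤ G := by
    intro x y hxy
    rw [hH, fromEdgeSet_adj] at hxy
    rcases List.mem_append.1 hxy.1 with h | h
    · exact p.adj_of_mem_edges h
    · exact q.adj_of_mem_edges h
  have hacyc : H.IsAcyclic := by
    intro u c hc
    have h1 := hG u (c.mapLe hHG) ((Walk.isCycle_mapLe hHG).2 hc)
    have h2 : c.edges ⊆ p.edges ++ q.edges := by
      intro e he
      have := c.edges_subset_edgeSet he
      rw [hH, edgeSet_fromEdgeSet] at this
      exact this.1
    have h3 := (hc.edges_nodup.subperm h2).length_le
    simp at h1 h3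
    omega
  have hmem : ∀ e ∈ p.edges ++ q.edges, e ∈ H.edgeSet := by
    intro e he
    rw [hH, edgeSet_fromEdgeSet]
    refine ⟨he, fun hd => ?_⟩
    rcases List.mem_append.1 he with h | h
    · exact G.not_isDiag_of_mem_edgeSet (p.edges_subset_edgeSet h) hd
    · exact G.not_isDiag_of_mem_edgeSet (q.edges_subset_edgeSet h) hd
  have hpH : ∀ e ∈ p.edges, e ∈ H.edgeSet := fun e he => hmem e (List.mem_append_left _ he)
  have hqH : ∀ e ∈ q.edges, e ∈ H.edgeSet := fun e he => hmem e (List.mem_append_right _ he)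
  have h1 : (p.transfer H hpH).IsPath := by
    rw [hacyc.isPath_iff_isChain, Walk.edges_transfer]; exact hp
  have h2 : (q.transfer H hqH).IsPath := by
    rw [hacyc.isPath_iff_isChain, Walk.edges_transfer]; exact hq
  have h3 := congrArg Subtype.val 
    ((hacyc.subsingleton_path v w).elim ⟨_, h1⟩ ⟨_, h2⟩)
  have h4 := congrArg Walk.support h3
  simp only [Walk.support_transfer] at h4
  exact Walk.ext_support h4

section Nonbacktracking

variable {V : Type*} [Fintype V] [DecidableEq V] (G : SimpleGraph V) [DecidableRel G.Adj]

/-- The darts that may follow `e` in a nonbacktracking walk. -/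
def nbSucc (e : G.Dart) : Finset G.Dart :=
  Finset.univ.filter fun e' => e'.fst = e.snd ∧ e' ≠ e.symm

/-- The ends of the nonbacktracking walks that begin with `e` and have `s` further steps. -/
def nbEnds : ℕ → G.Dart → Finset V
  | 0, e => {e.snd}
  | s + 1, e => (G.nbSucc e).biUnion (nbEnds s)

theorem card_nbSucc (e : G.Dart) : (G.nbSucc e).card = G.degree e.snd - 1 := by
  have : G.nbSucc e = (Finset.univ.filter fun e' : G.Dart => e'.fst = e.snd).erase e.symm := by
    ext e'
    simp [nbSucc, and_comm]
  rw [this, Finset.card_erase_of_mem (by simp), dart_fst_fiber_card_eq_degree]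

/-- Reversal exchanges predecessors and successors, so predecessors can be counted with
`card_nbSucc`. -/
theorem mem_nbSucc_symm {e e' : G.Dart} : e' ∈ G.nbSucc e ↔ e.symm ∈ G.nbSucc e'.symm := by
  simp only [nbSucc, Finset.mem_filter, Finset.mem_univ, true_and, Dart.symm_symm]
  constructor <;> rintro ⟨h1, h2⟩ <;> exact ⟨h1.symm, h2.symm⟩

theorem exists_walk_of_mem_nbEnds (s : ℕ) (e : G.Dart) {w : V} (hw : w ∈ G.nbEnds s e) :
    ∃ p : G.Walk e.snd w, p.length = s ∧ (e.edge :: p.edges).IsChain (· ≠ ·) := by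
  induction s generalizing e with
  | zero =>
    obtain rfl : w = e.snd := by simpa [nbEnds] using hw
    exact ⟨Walk.nil, rfl, by simp⟩
  | succ s ih =>
    obtain ⟨e', he', hw'⟩ := Finset.mem_biUnion.1 hw
    obtain ⟨p, hp, hchain⟩ := ih e' hw'
    obtain ⟨h1, h2⟩ : e'.fst = e.snd ∧ e' ≠ e.symm := by simpa [nbSucc] using he'
    refine ⟨Walk.cons (h1 ▸ e'.adj) p, by simp [hp], ?_⟩
    have hedge : s(e.snd, e'.snd) = e'.edge := by rw [← h1]; rfl
    rw [Walk.edges_cons, hedge]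
    refine List.IsChain.cons_cons ?_ hchain
    intro heq
    rcases (dart_edge_eq_iff e e').1 heq with rfl | h
    · exact e.adj.ne h1
    · exact h2 (by rw [h, Dart.symm_symm])

/-- A common end reached through two different first darts would give two distinct nonbacktracking
walks of length `s + 1` with the same ends. -/
theorem card_nbEnds_succ {s : ℕ}
    (hG : ∀ (v : V) (c : G.Walk v v), c.IsCycle → 2 * (s + 1) < c.length) (e : G.Dart) :
    (G.nbEnds (s + 1) e).card = ∑ e' ∈ G.nbSucc e, (G.nbEnds s e').card := by
  refine Finset.card_biUnion fun e₁ h₁ e₂ h₂ hne => Finset.disjoint_left.2 fun w hw₁ hw₂ => hne ?_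
  obtain ⟨p, hp, hpc⟩ := G.exists_walk_of_mem_nbEnds s e₁ hw₁
  obtain ⟨q, hq, hqc⟩ := G.exists_walk_of_mem_nbEnds s e₂ hw₂
  have h12 : e₁.fst = e₂.fst := by
    rw [Finset.mem_coe, nbSucc, Finset.mem_filter] at h₁ h₂
    rw [h₁.2.1, h₂.2.1]
  obtain ⟨⟨a, b⟩, hab⟩ := e₁
  obtain ⟨⟨a', b'⟩, hab'⟩ := e₂
  obtain rfl : a = a' := h12
  have := walk_eq_of_isChain_of_no_short_cycle hG (Walk.cons hab p) (Walk.cons hab' q) hpc hqc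
    (by simp [hp]) (by simp [hq])
  rw [Walk.cons.injEq] at this
  obtain rfl := this.1
  rfl

/-- By parity, all walks of a given length from a given vertex end on the same side. -/
theorem card_nbEnds_le (C : G.Coloring Bool) {m : ℕ}
    (hC : ∀ b, (Finset.univ.filter fun v => C v = b).card ≤ m) (s : ℕ) (e : G.Dart) :
    (G.nbEnds s e).card ≤ m := by
  refine (Finset.card_le_card fun w hw => ?_).trans (hC (if Even s then C e.snd else !C e.snd))
  obtain ⟨p, rfl, -⟩ := G.exists_walk_of_mem_nbEnds s e hw
  rw [Finset.mem_filter]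
  refine ⟨Finset.mem_univ _, ?_⟩
  have := C.even_length_iff_congr p
  split_ifs with h
  · cases h1 : C w <;> cases h2 : C e.snd <;> simp_all
  · cases h1 : C w <;> cases h2 : C e.snd <;> simp_all

/-- Double counting: weighting each dart by the inverse of the number of its successors, the
successor relation preserves the counting measure on darts. -/
theorem sum_dart_average_nbSucc (hdeg : ∀ v, 2 ≤ G.degree v) (F : G.Dart → ℝ) :
    ∑ e : G.Dart, (∑ e' ∈ G.nbSucc e, F e') / ((G.nbSucc e).card : ℝ) = ∑ e : G.Dart, F e := by
  simp only [Finset.sum_div]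
  rw [Finset.sum_comm' (t' := Finset.univ)
    (s' := fun e' => Finset.univ.filter fun e => e' ∈ G.nbSucc e) (by simp)]
  refine Finset.sum_congr rfl fun e' _ => ?_
  have hcard : (Finset.univ.filter fun e => e' ∈ G.nbSucc e).card = G.degree e'.fst - 1 := by
    rw [show G.degree e'.fst - 1 = (G.nbSucc e'.symm).card from (G.card_nbSucc e'.symm).symm]
    refine Finset.card_bij (fun e _ => e.symm) ?_ ?_ ?_
    · intro e he
      exact (G.mem_nbSucc_symm).1 (by simpa using he)
    · intro e _ f _ h
      simpa using congrArg Dart.symm h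
    · intro f hf
      refine ⟨f.symm, ?_, by simp⟩
      simpa [G.mem_nbSucc_symm (e := f.symm)] using hf
  calc _ = ∑ e ∈ Finset.univ.filter (fun e => e' ∈ G.nbSucc e),
        F e' / ((G.degree e'.fst - 1 : ℕ) : ℝ) := by
        refine Finset.sum_congr rfl fun e he => ?_
        have : e'.fst = e.snd := by
          rw [Finset.mem_filter, nbSucc, Finset.mem_filter] at he
          exact he.2.2.1
        rw [card_nbSucc, this]
    _ = F e' := by
        rw [Finset.sum_const, hcard, nsmul_eq_mul]
        have : ((G.degree e'.fst - 1 : ℕ) : ℝ) ≠ 0 := by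
          have := hdeg e'.fst
          exact_mod_cast (by omega : G.degree e'.fst - 1 ≠ 0)
        field_simp

theorem nbEnds_nonempty (hdeg : ∀ v, 2 ≤ G.degree v) (s : ℕ) (e : G.Dart) :
    (G.nbEnds s e).Nonempty := by
  induction s generalizing e with
  | zero => exact Finset.singleton_nonempty _
  | succ s ih =>
    have hpos : 0 < (G.nbSucc e).card := by
      have := hdeg e.snd
      rw [card_nbSucc]; omega
    obtain ⟨e', he'⟩ := Finset.card_pos.1 hpos
    obtain ⟨w, hw⟩ := ih e'
    exact ⟨w, Finset.mem_biUnion.2 ⟨e', he', hw⟩⟩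

/-- The inequality of arithmetic and geometric means, from concavity of the logarithm. -/
theorem log_sum_ge {ι : Type*} (t : Finset ι) (ht : t.Nonempty) (f : ι → ℝ)
    (hf : ∀ i ∈ t, 0 < f i) :
    Real.log t.card + (∑ i ∈ t, Real.log (f i)) / (t.card : ℝ) ≤ Real.log (∑ i ∈ t, f i) := by
  have hc : (0 : ℝ) < t.card := by exact_mod_cast ht.card_pos
  have := strictConcaveOn_log_Ioi.concaveOn.le_map_sum (t := t) (w := fun _ => (t.card : ℝ)⁻¹)
    (p := f) (fun _ _ => by positivity) (by simp [hc.ne']) hf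
  simp only [smul_eq_mul, ← Finset.mul_sum] at this
  rw [Real.log_mul (by positivity) (Finset.sum_pos hf ht).ne', Real.log_inv] at this
  rw [div_eq_inv_mul]
  linarith

/-- The number of nonbacktracking walks grows, in geometric mean, at least like the geometric mean
of the branching numbers. -/
theorem sum_log_card_nbEnds_ge (hdeg : ∀ v, 2 ≤ G.degree v) {s : ℕ}
    (hG : ∀ (v : V) (c : G.Walk v v), c.IsCycle → 2 * s < c.length) :
    (s : ℝ) * ∑ e : G.Dart, Real.log ((G.degree e.snd : ℝ) - 1) ≤
      ∑ e : G.Dart, Real.log ((G.nbEnds s e).card : ℝ) := by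
  induction s with
  | zero => simp [nbEnds]
  | succ s ih =>
    have ih := ih fun v c hc => by have := hG v c hc; omega
    -- Replacing each term by its average over successors leaves the total unchanged; then
    -- `log_sum_ge` applies dart by dart.
    rw [← G.sum_dart_average_nbSucc hdeg fun e => Real.log ((G.nbEnds s e).card : ℝ)] at ih
    rw [Nat.cast_succ, add_one_mul]
    refine (add_le_add_left ih _).trans ?_
    rw [← Finset.sum_add_distrib]
    refine Finset.sum_le_sum fun e _ => ?_
    have hd := hdeg e.snd
    have h1 : ((G.nbSucc e).card : ℝ) = (G.degree e.snd : ℝ) - 1 := by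
      rw [card_nbSucc, Nat.cast_sub (by omega), Nat.cast_one]
    have hne : (G.nbSucc e).Nonempty := by
      rw [← Finset.card_pos, card_nbSucc]; omega
    have h2 := log_sum_ge (G.nbSucc e) hne (fun e' => ((G.nbEnds s e').card : ℝ))
      fun e' _ => by exact_mod_cast (G.nbEnds_nonempty hdeg s e').card_pos
    rw [G.card_nbEnds_succ hG, Nat.cast_sum]
    rw [h1] at h2 ⊢
    linarith

theorem sum_dart_snd (f : V → ℝ) : ∑ e : G.Dart, f e.snd = ∑ v, (G.degree v : ℝ) * f v := by
  have : ∑ e : G.Dart, f e.snd = ∑ e : G.Dart, f e.fst :=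
    Fintype.sum_bijective Dart.symm Dart.symm_involutive.bijective _ _ fun e => by simp
  rw [this, ← Finset.sum_fiberwise Finset.univ fun e : G.Dart => e.fst]
  refine Finset.sum_congr rfl fun v _ => ?_
  rw [← dart_fst_fiber_card_eq_degree, ← nsmul_eq_mul, ← Finset.sum_const]
  exact Finset.sum_congr rfl fun e he => by rw [(Finset.mem_filter.1 he).2]

/-- The second derivative is `(x - 2) / (x - 1) ^ 2`, nonnegative from 2 on: hence the reduction to
minimum degree two. -/
theorem convexOn_mul_log_sub_one :
    ConvexOn ℝ (Set.Ici 2) fun x : ℝ => x * Real.log (x - 1) := by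
  have hd : ∀ x ∈ Set.Ioi (2 : ℝ),
      HasDerivAt (fun x : ℝ => x * Real.log (x - 1)) (Real.log (x - 1) + x / (x - 1)) x := by
    intro x hx
    have hx' : x - 1 ≠ 0 := by have := Set.mem_Ioi.1 hx; linarith
    have := (hasDerivAt_id x).mul (((hasDerivAt_id x).sub_const 1).log hx')
    simpa [div_eq_mul_inv, Pi.mul_def] using this
  have hd2 : ∀ x ∈ Set.Ioi (2 : ℝ),
      HasDerivAt (fun x : ℝ => Real.log (x - 1) + x / (x - 1)) ((x - 2) / (x - 1) ^ 2) x := by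
    intro x hx
    have hx' : x - 1 ≠ 0 := by have := Set.mem_Ioi.1 hx; linarith
    have := (((hasDerivAt_id x).sub_const 1).log hx').add
      ((hasDerivAt_id x).div ((hasDerivAt_id x).sub_const 1) hx')
    convert! this using 1
    simp only [id]
    field_simp
    ring
  refine convexOn_of_hasDerivWithinAt2_nonneg (convex_Ici 2) ?_
    (f' := fun x => Real.log (x - 1) + x / (x - 1)) (f'' := fun x => (x - 2) / (x - 1) ^ 2) ?_ ?_ ?_
  · refine continuousOn_id.mul (ContinuousOn.log (by fun_prop) fun x hx => ?_)
    have := Set.mem_Ici.1 hx; linarith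
  · rw [interior_Ici]; exact fun x hx => (hd x hx).hasDerivWithinAt
  · rw [interior_Ici]; exact fun x hx => (hd2 x hx).hasDerivWithinAt
  · rw [interior_Ici]
    intro x hx
    have := Set.mem_Ioi.1 hx
    exact div_nonneg (by linarith) (sq_nonneg _)

/-- The Moore bound for irregular bipartite graphs (Alon, Hoory, Linial), for minimum degree at
least two: the average degree exceeds one by at most the `s`-th root of the size of a side. -/
theorem moore_bound_of_two_le_degree [Nonempty V] (hdeg : ∀ v, 2 ≤ G.degree v) (C : G.Coloring Bool)
    {m s : ℕ} (hC : ∀ b, (Finset.univ.filter fun v => C v = b).card ≤ m)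
    (hG : ∀ (v : V) (c : G.Walk v v), c.IsCycle → 2 * s < c.length) :
    ((2 * G.edgeFinset.card : ℝ) / Fintype.card V - 1) ^ s ≤ m := by
  set N : ℝ := (Fintype.card V : ℝ) with hN
  have hNpos : 0 < N := by rw [hN]; exact_mod_cast Fintype.card_pos
  have hsum : ∑ v, (G.degree v : ℝ) = 2 * G.edgeFinset.card := by
    exact_mod_cast G.sum_degrees_eq_twice_card_edges
  set D : ℝ := 2 * G.edgeFinset.card / N with hD
  have hDN : 2 * (G.edgeFinset.card : ℝ) = N * D := by rw [hD]; field_simp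
  have hD2 : 2 ≤ D := by
    rw [hD, le_div_iff₀ hNpos, ← hsum]
    calc 2 * N = ∑ _v : V, (2 : ℝ) := by
          rw [Finset.sum_const, Finset.card_univ, nsmul_eq_mul, mul_comm]
      _ ≤ _ := Finset.sum_le_sum fun v _ => by exact_mod_cast hdeg v
  have hjensen : D * Real.log (D - 1) ≤
      N⁻¹ * ∑ v, (G.degree v : ℝ) * Real.log ((G.degree v : ℝ) - 1) := by
    have := convexOn_mul_log_sub_one.map_sum_le (t := Finset.univ) (w := fun _ : V => N⁻¹)
      (p := fun v => (G.degree v : ℝ)) (fun _ _ => by positivity)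
      (by rw [Finset.sum_const, Finset.card_univ, nsmul_eq_mul, ← hN, mul_inv_cancel₀ hNpos.ne'])
      (fun v _ => by rw [Set.mem_Ici]; exact_mod_cast hdeg v)
    simp only [smul_eq_mul, ← Finset.mul_sum, hsum] at this
    rwa [inv_mul_eq_div, ← hD] at this
  have hgrow := G.sum_log_card_nbEnds_ge hdeg hG
  rw [G.sum_dart_snd fun v => Real.log ((G.degree v : ℝ) - 1)] at hgrow
  obtain ⟨v⟩ := ‹Nonempty V›
  have hm : ∑ e : G.Dart, Real.log ((G.nbEnds s e).card : ℝ) ≤ N * D * Real.log m := by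
    calc _ ≤ ∑ _e : G.Dart, Real.log m := Finset.sum_le_sum fun e _ =>
          Real.log_le_log (by exact_mod_cast (G.nbEnds_nonempty hdeg s e).card_pos)
            (by exact_mod_cast G.card_nbEnds_le C hC s e)
      _ = N * D * Real.log m := by
          rw [Finset.sum_const, Finset.card_univ, dart_card_eq_twice_card_edges, nsmul_eq_mul,
            ← hDN]
          push_cast; ring
  have hND : 0 < N * D := mul_pos hNpos (by linarith)
  -- There are `N * D` darts; dividing by this number compares the average growth with the trivial
  -- bound `m` on the number of ends.
  have hfin : (s : ℝ) * Real.log (D - 1) ≤ Real.log m := by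
    have h1 : N * (D * Real.log (D - 1)) ≤
        ∑ v, (G.degree v : ℝ) * Real.log ((G.degree v : ℝ) - 1) := by
      have := mul_le_mul_of_nonneg_left hjensen hNpos.le
      rwa [← mul_assoc N N⁻¹, mul_inv_cancel₀ hNpos.ne', one_mul] at this
    have h2 := (mul_le_mul_of_nonneg_left h1 (Nat.cast_nonneg s)).trans (hgrow.trans hm)
    refine le_of_mul_le_mul_left ?_ hND
    linarith
  have hmpos : 0 < m := lt_of_lt_of_le
    (Finset.card_pos.2 ⟨v, by simp⟩) (hC (C v))
  rw [← Real.log_pow] at hfin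
  exact (Real.log_le_log_iff (pow_pos (by linarith) s) (by exact_mod_cast hmpos)).1 hfin

end Nonbacktracking

/-- A bipartite graph with sides of size at most `m` and no cycle of length at most `2 s` has at
most `c |V|` edges, if `1 ≤ c` and `m ≤ c ^ s`. -/
theorem card_edgeFinset_le_of_no_short_cycle {m s : ℕ} (hs : s ≠ 0) {c : ℝ} (hc : 1 ≤ c)
    (hm : (m : ℝ) ≤ c ^ s) {V : Type*} [Fintype V] [DecidableEq V] (G : SimpleGraph V)
    [DecidableRel G.Adj] (C : G.Coloring Bool)
    (hC : ∀ b, (Finset.univ.filter fun v => C v = b).card ≤ m)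
    (hG : ∀ (v : V) (p : G.Walk v v), p.IsCycle → 2 * s < p.length) :
    (G.edgeFinset.card : ℝ) ≤ c * Fintype.card V := by
  obtain ⟨k, hk⟩ : ∃ k, Fintype.card V = k := ⟨_, rfl⟩
  induction k generalizing V with
  | zero =>
    have := Fintype.card_eq_zero_iff.1 hk
    have : G.edgeFinset = ∅ := Finset.eq_empty_of_forall_notMem fun e =>
      Sym2.ind (fun v _ => isEmptyElim v) e
    simp [this]
  | succ k ih =>
    have : Nonempty V := Fintype.card_pos_iff.1 (by omega)
    by_cases hdeg : ∀ v, 2 ≤ G.degree v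
    · have h := G.moore_bound_of_two_le_degree hdeg C hC hG
      -- Otherwise the average degree minus one exceeds `2 c - 1 ≥ c`, so its `s`-th power exceeds
      -- `m`.
      by_contra! hlt
      have hN : (0 : ℝ) < Fintype.card V := by exact_mod_cast Fintype.card_pos
      have h1 : 2 * c < 2 * G.edgeFinset.card / (Fintype.card V : ℝ) := by
        rw [lt_div_iff₀ hN]; linarith
      have h2 := pow_lt_pow_left₀
        (by linarith : c < 2 * G.edgeFinset.card / (Fintype.card V : ℝ) - 1) (by linarith) hs
      linarith
    -- Deleting a vertex of degree at most one loses at most `1 ≤ c` edges.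
    · push Not at hdeg
      obtain ⟨v, hv⟩ := hdeg
      have hcard : Fintype.card ({v}ᶜ : Set V) = k := by
        rw [Fintype.card_compl_set, hk]; simp
      let f : G.induce {v}ᶜ ↪g G := Embedding.induce _
      have key := ih (G.induce {v}ᶜ) (C.comp f.toHom) ?_ ?_ ?_
      · rw [G.card_edgeFinset_induce_compl_singleton v,
          G.card_edgeFinset_deleteIncidenceSet v, hcard] at key
        have h1 : (G.edgeFinset.card : ℝ) ≤ ((G.edgeFinset.card - G.degree v : ℕ) : ℝ) + 1 := by
          exact_mod_cast (by omega : G.edgeFinset.card ≤ G.edgeFinset.card - G.degree v + 1)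
        rw [hk]
        push_cast
        linarith
      · intro b
        refine le_trans ?_ (hC b)
        refine Finset.card_le_card_of_injOn (fun x => x.1) ?_ Subtype.val_injective.injOn
        intro x hx
        simpa [f] using hx
      · intro u p hp
        have := hG _ (p.map f.toHom) (hp.map f.injective)
        simpa using this
      · exact hcard

end SimpleGraph

/-! ### Strategies of linear games and their winning graphs -/

namespace NonlocalGame

variable {n d : ℕ}

/-- The pairs of questions on which the answers `a`, `b` win the linear game. -/
def winningPairs (k : Fin n → Fin n → ℕ) (a b : Fin n → ZMod d) : Finset (Fin n × Fin n) :=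
  Finset.univ.filter fun z => b z.2 = a z.1 + (k z.1 z.2 : ZMod d)

theorem winProb_linearGame [NeZero n] (k : Fin n → Fin n → ℕ) (a b : Fin n → ZMod d) :
    (linearGame d k).winProb a b = ((winningPairs k a b).card : ℝ) / (n : ℝ) ^ 2 := by
  classical
  simp only [winProb, linearGame, ← Finset.mul_sum, winningPairs, Finset.card_filter]
  rw [Nat.cast_sum, Fintype.sum_prod_type]
  push_cast
  rw [one_div, inv_mul_eq_div, sq]
  congr 1
  refine Finset.sum_congr rfl fun x _ => Finset.sum_congr rfl fun y _ => ?_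
  by_cases h : b y = a x + (k x y : ZMod d)
  · exact (if_pos h).trans (if_pos h).symm
  · exact (if_neg h).trans (if_neg h).symm

theorem winProb_le_classicalValue [NeZero n] [NeZero d] (k : Fin n → Fin n → ℕ) (a b : Fin n → ZMod d) :
    (linearGame d k).winProb a b ≤ (linearGame d k).classicalValue :=
  le_ciSup (f := fun st : (Fin n → ZMod d) × (Fin n → ZMod d) =>
    (linearGame d k).winProb st.1 st.2) (Set.finite_range _).bddAbove (a, b)

theorem classicalValue_linearGame_le [NeZero n] (k : Fin n → Fin n → ℕ) {c : ℝ}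
    (h : ∀ a b : Fin n → ZMod d, ((winningPairs k a b).card : ℝ) ≤ c * (n : ℝ) ^ 2) :
    (linearGame d k).classicalValue ≤ c := by
  refine ciSup_le fun st => ?_
  have hn : (0 : ℝ) < n := by exact_mod_cast NeZero.pos n
  rw [winProb_linearGame, div_le_iff₀ (by positivity)]
  exact h _ _

/-- A strategy that wins on the pairs of questions of a spanning double star. -/
theorem le_classicalValue_linearGame [NeZero n] [NeZero d] (k : Fin n → Fin n → ℕ) :
    (2 * (n : ℝ) - 1) / (n : ℝ) ^ 2 ≤ (linearGame d k).classicalValue := by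
  -- Starting from `a 0 = 0`, row 0 forces `b`, and then column 0 forces `a`.
  set a : Fin n → ZMod d := fun x => (k 0 0 : ZMod d) - k x 0 with ha
  set b : Fin n → ZMod d := fun y => (k 0 y : ZMod d) with hb
  refine le_trans ?_ (winProb_le_classicalValue k a b)
  rw [winProb_linearGame]
  gcongr
  have hsub : (Finset.univ.image fun y : Fin n => ((0 : Fin n), y)) ∪
      ((Finset.univ.erase 0).image fun x : Fin n => (x, (0 : Fin n))) ⊆ winningPairs k a b := by
    intro z hz
    rw [winningPairs, Finset.mem_filter]
    refine ⟨Finset.mem_univ _, ?_⟩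
    rcases Finset.mem_union.1 hz with h | h
    · obtain ⟨y, -, rfl⟩ := Finset.mem_image.1 h
      simp [ha, hb]
    · obtain ⟨x, -, rfl⟩ := Finset.mem_image.1 h
      simp [ha, hb]
  have hcard := Finset.card_le_card hsub
  rw [Finset.card_union_of_disjoint, Finset.card_image_of_injective,
    Finset.card_image_of_injective, Finset.card_erase_of_mem (Finset.mem_univ _),
    Finset.card_univ, Fintype.card_fin] at hcard
  · have hn := NeZero.pos n
    have h2 : ((2 * n : ℕ) : ℝ) ≤ (((winningPairs k a b).card + 1 : ℕ) : ℝ) := by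
      exact_mod_cast (by omega)
    push_cast at h2
    linarith
  · intro x x' h
    exact congrArg Prod.fst h
  · intro y y' h
    exact congrArg Prod.snd h
  · rw [Finset.disjoint_left]
    intro z h h'
    obtain ⟨y, -, rfl⟩ := Finset.mem_image.1 h
    obtain ⟨x, hx, h⟩ := Finset.mem_image.1 h'
    exact (Finset.mem_erase.1 hx).1 (congrArg Prod.fst h)

/-- The bipartite graph of the winning pairs of questions. -/
def winningGraph (k : Fin n → Fin n → ℕ) (a b : Fin n → ZMod d) :
    SimpleGraph (Fin n ⊕ Fin n) where
  Adj
    | .inl x, .inr y => (x, y) ∈ winningPairs k a b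
    | .inr y, .inl x => (x, y) ∈ winningPairs k a b
    | _, _ => False
  symm := ⟨by rintro (x | x) (y | y) h <;> exact h⟩
  loopless := ⟨by rintro (x | x) h <;> exact h⟩

/-- The edge of the complete bipartite graph given by a pair of questions. -/
def pairEdge (z : Fin n × Fin n) : Sym2 (Fin n ⊕ Fin n) := s(.inl z.1, .inr z.2)

theorem pairEdge_injective : Function.Injective (pairEdge (n := n)) := by
  rintro ⟨x, y⟩ ⟨x', y'⟩ h
  simpa [pairEdge] using h

variable (k : Fin n → Fin n → ℕ) (a b : Fin n → ZMod d)

/-- The colouring of the winning graph by the two players. -/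
def winningGraphColoring : (winningGraph k a b).Coloring Bool :=
  SimpleGraph.Coloring.mk Sum.isLeft (by
    rintro (x | x) (y | y) h
    · exact h.elim
    · simp
    · simp
    · exact h.elim)

theorem card_winningGraphColoring_fiber_le (c : Bool) :
    (Finset.univ.filter fun v => winningGraphColoring k a b v = c).card ≤ n := by
  have h : ∀ v, winningGraphColoring k a b v = Sum.isLeft v := fun _ => rfl
  simp only [h]
  have : (Finset.univ.filter fun v : Fin n ⊕ Fin n => Sum.isLeft v = c) ⊆
      Finset.univ.image (fun x : Fin n => if c then Sum.inl x else Sum.inr x) := by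
    rintro (x | x) hx
    · obtain rfl : true = c := by simpa using hx
      exact Finset.mem_image.2 ⟨x, Finset.mem_univ _, rfl⟩
    · obtain rfl : false = c := by simpa using hx
      exact Finset.mem_image.2 ⟨x, Finset.mem_univ _, rfl⟩
  exact (Finset.card_le_card this).trans (Finset.card_image_le.trans (by simp))

theorem card_winningPairs_le [Fintype (winningGraph k a b).edgeSet] :
    (winningPairs k a b).card ≤ (winningGraph k a b).edgeFinset.card := by
  classical
  rw [← Finset.card_image_of_injective _ pairEdge_injective]
  refine Finset.card_le_card fun e he => ?_
  obtain ⟨z, hz, rfl⟩ := Finset.mem_image.1 he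
  rw [SimpleGraph.mem_edgeFinset]
  exact hz

/-- The edges of a walk in the winning graph split into those traversed from Alice to Bob and those
traversed from Bob to Alice; the difference of the sums of their exponents is the difference of the
answers at the ends. -/
theorem exists_split_edges {u v : Fin n ⊕ Fin n} (p : (winningGraph k a b).Walk u v) :
    ∃ K L : Multiset (Fin n × Fin n),
      (K + L).map pairEdge = (p.edges : Multiset (Sym2 (Fin n ⊕ Fin n))) ∧
      (K.card : ℤ) - L.card = u.isLeft.toNat - v.isLeft.toNat ∧
      (K.map fun z => (k z.1 z.2 : ZMod d)).sum - (L.map fun z => (k z.1 z.2 : ZMod d)).sum =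
        Sum.elim a b v - Sum.elim a b u := by
  induction p with
  | nil => exact ⟨0, 0, by simp⟩
  | @cons u w v h p ih =>
    obtain ⟨K, L, h1, h2, h3⟩ := ih
    rcases u with x | y <;> rcases w with x' | y'
    · exact h.elim
    · refine ⟨(x, y') ::ₘ K, L, ?_, ?_, ?_⟩
      · rw [Multiset.cons_add, Multiset.map_cons, h1]; rfl
      · simp at h2 ⊢; omega
      · have hw : b y' = a x + (k x y' : ZMod d) := (Finset.mem_filter.1 h).2
        simp only [Multiset.map_cons, Multiset.sum_cons, Sum.elim_inl, Sum.elim_inr] at h3 ⊢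
        rw [hw] at h3
        linear_combination h3
    · refine ⟨K, (x', y) ::ₘ L, ?_, ?_, ?_⟩
      · rw [Multiset.add_cons, Multiset.map_cons, h1, pairEdge, Sym2.eq_swap]; rfl
      · simp at h2 ⊢; omega
      · have hw : b y = a x' + (k x' y : ZMod d) := (Finset.mem_filter.1 h).2
        simp only [Multiset.map_cons, Multiset.sum_cons, Sum.elim_inl, Sum.elim_inr] at h3 ⊢
        rw [hw]
        linear_combination h3
    · exact h.elim

end NonlocalGame

/-! ### The games built from Rudin's set -/

open NonlocalGame

theorem IsRudinArray.no_short_cycle {n s p : ℕ} {k : Fin n → Fin n → ℕ}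
    (hk : IsRudinArray n s p k) (hs : 1 ≤ s) (hsn : s ≤ n)
    (a b : Fin n → ZMod ((s * p) ^ s)) (v : Fin n ⊕ Fin n)
    (c : (winningGraph k a b).Walk v v) (hc : c.IsCycle) : 2 * s < c.length := by
  by_contra! hlen
  have hsp : s < p := lt_of_le_of_lt (hsn.trans (Nat.le_self_pow two_ne_zero n)) hk.lt_p
  obtain ⟨K, L, h1, h2, h3⟩ := exists_split_edges k a b c
  have hnd : (K + L).Nodup := by
    apply Multiset.Nodup.of_map pairEdge
    rw [h1]
    exact Multiset.coe_nodup.2 hc.edges_nodup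
  -- A closed walk crosses between the sides equally often in each direction.
  have hcard : K.card = L.card := by
    rw [sub_self] at h2; omega
  have hlen' : K.card + L.card = c.length := by
    have := congrArg Multiset.card h1
    simpa using this
  have hidx : ∀ x y, ∃ t, t < p ∧ rudinInt s p t = k x y := fun x y => by
    simpa [rudinSet] using hk.mem x y
  choose t htp ht using hidx
  let f : Fin n × Fin n → ℕ := fun z => t z.1 z.2
  have hf : Function.Injective f := fun z z' h => hk.injective (by
    simp only [← ht]
    exact congrArg _ h)
  have hsum : ∀ M : Multiset (Fin n × Fin n),
      ((((M.map f).map (rudinInt s p)).sum : ℕ) : ZMod ((s * p) ^ s)) =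
        (M.map fun z => (k z.1 z.2 : ZMod ((s * p) ^ s))).sum := by
    intro M
    rw [Multiset.map_map, Nat.cast_multiset_sum, Multiset.map_map]
    simp only [Function.comp_def, f, ht]
  have hmod : ((K.map f).map (rudinInt s p)).sum ≡
      ((L.map f).map (rudinInt s p)).sum [MOD (s * p) ^ s] := by
    rw [← ZMod.natCast_eq_natCast_iff, hsum, hsum]
    exact sub_eq_zero.1 (h3.trans (sub_self _))
  have hlt : ∀ M : Multiset (Fin n × Fin n), ∀ i ∈ M.map f, i < p := by
    intro M i hi
    obtain ⟨z, -, rfl⟩ := Multiset.mem_map.1 hi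
    exact htp _ _
  have hKL : K = L := Multiset.map_injective hf
    (multiset_eq_of_rudinInt_sum_modEq hs hk.prime hsp (hlt K) (hlt L) (by simpa using hcard)
      (by rw [Multiset.card_map]; omega) hmod)
  subst hKL
  -- A cycle repeats no edge, so `K` and `L` are disjoint; being equal, they are empty.
  have hK0 : K = 0 := Multiset.eq_zero_of_forall_notMem fun z hz =>
    Multiset.disjoint_left.1 (Multiset.nodup_add.1 hnd).2.2 hz hz
  have := hc.three_le_length
  simp [hK0] at hlen'
  omega

theorem IsRudinArray.classicalValue_le {n s p : ℕ} [NeZero n] {k : Fin n → Fin n → ℕ}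
    (hk : IsRudinArray n s p k) (hs : 1 ≤ s) (hsn : s ≤ n) :
    (linearGame ((s * p) ^ s) k).classicalValue ≤ 2 * (n : ℝ) ^ (-1 + 1 / (s : ℝ)) := by
  classical
  have hn1 : (1 : ℝ) ≤ n := by exact_mod_cast NeZero.one_le
  have hn0 : (0 : ℝ) < n := by linarith
  refine classicalValue_linearGame_le k fun a b => ?_
  have hcyc := hk.no_short_cycle hs hsn a b
  have hroot : ((n : ℝ) ^ (1 / (s : ℝ))) ^ s = n := by
    rw [one_div, Real.rpow_inv_natCast_pow hn0.le (by omega)]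
  have h := SimpleGraph.card_edgeFinset_le_of_no_short_cycle (m := n) (s := s) (by omega)
    (Real.one_le_rpow hn1 (by positivity)) hroot.ge (winningGraph k a b)
    (winningGraphColoring k a b) (card_winningGraphColoring_fiber_le k a b) hcyc
  calc ((winningPairs k a b).card : ℝ) ≤ (winningGraph k a b).edgeFinset.card := by
        exact_mod_cast card_winningPairs_le k a b
    _ ≤ (n : ℝ) ^ (1 / (s : ℝ)) * (n + n) := by simpa using h
    _ = 2 * (n : ℝ) ^ (-1 + 1 / (s : ℝ)) * (n : ℝ) ^ 2 := by
        rw [Real.rpow_add hn0, Real.rpow_neg_one]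
        field_simp
        ring

theorem IsRudinArray.classicalValue_le_of_eq {n p : ℕ} [NeZero n] {k : Fin n → Fin n → ℕ}
    (hk : IsRudinArray n n p k) :
    (linearGame ((n * p) ^ n) k).classicalValue ≤ (2 * (n : ℝ) - 1) / (n : ℝ) ^ 2 := by
  classical
  have hn1 : 1 ≤ n := NeZero.one_le
  refine classicalValue_linearGame_le k fun a b => ?_
  have hn0 : (n : ℝ) ≠ 0 := by exact_mod_cast NeZero.ne n
  rw [div_mul_cancel₀ _ (by positivity)]
  -- A cycle on `2 n` vertices has length at most `2 n`, so for `s = n` every cycle is excluded.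
  have hacyc : (winningGraph k a b).IsAcyclic := by
    intro v c hc
    have h1 := hk.no_short_cycle hn1 le_rfl a b v c hc
    have h2 := hc.support_nodup.length_le_card
    simp at h2
    omega
  have h1 := (card_winningPairs_le k a b).trans_lt hacyc.card_edgeFinset_lt
  rw [Fintype.card_sum, Fintype.card_fin] at h1
  have h2 : (((winningPairs k a b).card + 1 : ℕ) : ℝ) ≤ ((n + n : ℕ) : ℝ) := by
    exact_mod_cast h1
  push_cast at h2
  linarith

theorem IsRudinArray.one_le_outputs {n s p : ℕ} {k : Fin n → Fin n → ℕ}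
    (hk : IsRudinArray n s p k) (hs : 1 ≤ s) : 1 ≤ (s * p) ^ s :=
  Nat.one_le_pow _ _ (Nat.mul_pos hs hk.prime.pos)

theorem IsRudinArray.outputs_le {n s p : ℕ} {k : Fin n → Fin n → ℕ}
    (hk : IsRudinArray n s p k) : (s * p) ^ s ≤ (2 * s * n ^ 2) ^ s := by
  refine Nat.pow_le_pow_left ?_ s
  calc s * p ≤ s * (2 * n ^ 2) := Nat.mul_le_mul_left s hk.p_lt.le
    _ = 2 * s * n ^ 2 := by ring

theorem proposition3 (n : ℕ) [NeZero n] (hn : 2 ≤ n) :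
    -- first part: the games built from `A(s, p)` exist, and each of them satisfies the bounds
    (∀ s : ℕ, 1 ≤ s → s ≤ n →
      (∃ (p : ℕ) (k : Fin n → Fin n → ℕ), IsRudinArray n s p k) ∧
      ∀ (p : ℕ) (k : Fin n → Fin n → ℕ), IsRudinArray n s p k →
        ∃ d : ℕ, d = (s * p) ^ s ∧ 1 ≤ d ∧ d ≤ (2 * s * n ^ 2) ^ s ∧
          (linearGame d k).classicalValue ≤ 2 * (n : ℝ) ^ (-1 + 1 / (s : ℝ))) ∧
    -- second part: the case `s = n`
    ((∃ (p : ℕ) (k : Fin n → Fin n → ℕ), IsRudinArray n n p k) ∧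
      ∀ (p : ℕ) (k : Fin n → Fin n → ℕ), IsRudinArray n n p k →
        ∃ d : ℕ, d = (n * p) ^ n ∧ 1 ≤ d ∧ d ≤ 2 ^ n * n ^ (3 * n) ∧
          (linearGame d k).classicalValue = (2 * (n : ℝ) - 1) / (n : ℝ) ^ 2) ∧
    -- this value is the smallest possible one among all `n × n` linear games
    (∀ d : ℕ, 1 ≤ d → ∀ k : Fin n → Fin n → ℕ,
      (2 * (n : ℝ) - 1) / (n : ℝ) ^ 2 ≤ (linearGame d k).classicalValue) := by

  refine ⟨fun s hs hsn => ⟨exists_isRudinArray hn hs hsn, fun p k hk =>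
      ⟨_, rfl, hk.one_le_outputs hs, hk.outputs_le, hk.classicalValue_le hs hsn⟩⟩,
    ⟨exists_isRudinArray hn (by omega) le_rfl, fun p k hk => ?_⟩, fun d hd k => ?_⟩
  · have h1 := hk.one_le_outputs (by omega)
    have : NeZero ((n * p) ^ n) := ⟨by omega⟩
    refine ⟨_, rfl, h1, hk.outputs_le.trans_eq ?_,
      le_antisymm hk.classicalValue_le_of_eq (le_classicalValue_linearGame k)⟩
    rw [pow_mul, ← mul_pow]
    ring
  · have : NeZero d := ⟨by omega⟩
    exact le_classicalValue_linearGame k
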